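/- Let $d\ge 1$ and let $F$ be a probability distribution on $\mathbb{R}^d$ that is elliptically symmetric about $\theta\in\mathbb{R}^d$ with an associated positive definite matrix $\Sigma$: there is a real random variable $Y$ with $Y\stackrel{d}{=}-Y$ such that, for $X\sim F$ and every unit vector $u$, $u'(X-\theta)\stackrel{d}{=}\sqrt{u'\Sigma u}\,Y$. Assume that $Y$ has a continuous density $p$ with $p(0)\,p(m_0)>0$, where $m_0=\mathrm{MAD}(Y)$. For a probability distribution $H$ on $\mathbb{R}^d$ let $H_u$ be the law of $u'X$, $X\sim H$, and put $$O(x,H)=\sup_{\|u\|=1}\frac{u'x-\mathrm{Med}(H_u)}{\mathrm{MAD}(H_u)},\qquad PD(x,H)=\frac1{1+O(x,H)},$$ where $\mathrm{Med}$ is the median (the midpoint of the interval of medians) and $\mathrm{MAD}$ is the median absolute deviation from it. For weight functions $w_1,w_2$ on $[0,1]$ let $$L(H)=\frac{\int x\,w_1(PD(x,H))\,dH(x)}{\int w_1(PD(x,H))\,dH(x)},\qquad PWS(H)=\frac{\int (x-L(H))(x-L(H))'\,w_2(PD(x,H))\,dH(x)}{\int w_2(PD(x,H))\,dH(x)}.$$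 We say that $PWS(H)$ is well defined if $\mathrm{MAD}(H_u)>0$ for all unit $u$, $O(x,H)<\infty$ for all $x$, and, for $i=1,2$, $w_i(PD(\cdot,H))$ is $H$-integrable with $\int w_i(PD(x,H))\,dH(x)>0$ and $\int\|x\|^i w_i(PD(x,H))\,dH(x)<\infty$. Assume that $w_1,w_2$ are differentiable on $[0,1]$, $w_1'$ is continuous and $w_2'$ is Lipschitz continuous on $[0,1]$, $w_i'(r)=O(r^i)$ as $r\to0+$, $w_i(0)=0$, and $w_i>0$ on $(0,1]$, $i=1,2$. Fix a matrix norm $\|\cdot\|$ (that is, any norm on the space of real $d\times d$ matrices). For $\varepsilon\in[0,1]$ and a probability distribution $G$ on $\mathbb{R}^d$ let $F(\varepsilon,G)=(1-\varepsilon)F+\varepsilon G$, and let $$B(\varepsilon;PWS,F)=\sup_G\|PWS(F(\varepsilon,G))-PWS(F)\|,$$ the supremum being over all probability distributions $G$ on $\mathbb{R}^d$ for which $PWS(F(\varepsilon,G))$ is well defined. Then $PWS(F(\varepsilon,G))$ is well defined for every $0\le\varepsilon<1/2$ and every $G$, and the asymptotic breakdown point of $PWS$ at $F$ is exactly $1/2$: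 $$\varepsilon^*(PWS,F)=\min\{\varepsilon\in[0,1]: B(\varepsilon;PWS,F)=\infty\}=\tfrac12 .$$ -/

import Mathlib

open MeasureTheory Set Filter Topology
open scoped ENNReal NNReal Matrix

namespace PDScatter

noncomputable section

/-- `ℝ^d` with the Euclidean norm. -/
abbrev Vec (d : ℕ) := EuclideanSpace ℝ (Fin d)

/-- The median of a probability law on `ℝ`: the midpoint of the interval of all medians. This is
the affine equivariant choice (the lower and the upper median are interchanged by `t ↦ -t`), and it
is the usual sample median for empirical laws. -/
def median (ν : Measure ℝ) : ℝ :=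
  (sInf {t : ℝ | 1 / 2 ≤ ν.real (Iic t)} + sSup {t : ℝ | 1 / 2 ≤ ν.real (Ici t)}) / 2

/-- The median absolute deviation of a probability law on `ℝ`: the median of `|Y - Med(Y)|`. -/
def mad (ν : Measure ℝ) : ℝ :=
  median (ν.map fun t => |t - median ν|)

/-- `F_u`, the law of `u'X` for `X ∼ F`. -/
def proj {d : ℕ} (F : Measure (Vec d)) (u : Vec d) : Measure ℝ :=
  F.map fun x => inner ℝ u x

/-- The outlyingness `O(x, F) = sup_{‖u‖ = 1} (u'x - Med(F_u)) / MAD(F_u)`. It is meaningful when all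
`MAD(F_u)` are positive and the supremum is finite, see `WellDefined`. -/
def outlyingness {d : ℕ} (x : Vec d) (F : Measure (Vec d)) : ℝ :=
  sSup ((fun u : Vec d => (inner ℝ u x - median (proj F u)) / mad (proj F u)) ''
    Metric.sphere (0 : Vec d) 1)

/-- The projection depth `PD(x, F) = 1 / (1 + O(x, F))`. -/
def projectionDepth {d : ℕ} (x : Vec d) (F : Measure (Vec d)) : ℝ :=
  1 / (1 + outlyingness x F)

/-- The depth weighted mean `L(F) = ∫ x w(PD(x, F)) dF(x) / ∫ w(PD(x, F)) dF(x)`. -/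
def depthMean {d : ℕ} (w : ℝ → ℝ) (F : Measure (Vec d)) : Vec d :=
  (∫ x, w (projectionDepth x F) ∂F)⁻¹ • ∫ x, w (projectionDepth x F) • x ∂F

/-- The projection depth weighted scatter matrix
`PWS(F) = ∫ (x - L(F)) (x - L(F))' w₂(PD(x, F)) dF(x) / ∫ w₂(PD(x, F)) dF(x)`, where `L(F)` is the
depth weighted mean with the weight function `w₁`. -/
def pws {d : ℕ} (w₁ w₂ : ℝ → ℝ) (F : Measure (Vec d)) : Matrix (Fin d) (Fin d) ℝ :=
  Matrix.of fun i j =>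
    (∫ x, (x i - depthMean w₁ F i) * (x j - depthMean w₁ F j) * w₂ (projectionDepth x F) ∂F) /
      ∫ x, w₂ (projectionDepth x F) ∂F

/-- `PWS(F)` is well defined (no division by zero, no divergent supremum or integral): every
`MAD(F_u)` is positive, every outlyingness is finite, and the weights have positive total mass
(in particular they are integrable) and finite moments of order `1` (for `w₁`) and `2` (for `w₂`). -/
structure WellDefined {d : ℕ} (w₁ w₂ : ℝ → ℝ) (F : Measure (Vec d)) : Prop where
  mad_pos : ∀ u : Vec d, ‖u‖ = 1 → 0 < mad (proj F u)
  outlyingness_finite : ∀ x : Vec d,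
    BddAbove ((fun u : Vec d => (inner ℝ u x - median (proj F u)) / mad (proj F u)) ''
      Metric.sphere (0 : Vec d) 1)
  mass_pos₁ : 0 < ∫ x, w₁ (projectionDepth x F) ∂F
  mass_pos₂ : 0 < ∫ x, w₂ (projectionDepth x F) ∂F
  moment₁ : Integrable (fun x => ‖x‖ * w₁ (projectionDepth x F)) F
  moment₂ : Integrable (fun x => ‖x‖ ^ 2 * w₂ (projectionDepth x F)) F

/-- The contaminated law `F(ε, G) = (1 - ε) F + ε G`. -/
def contaminate {d : ℕ} (F G : Measure (Vec d)) (ε : ℝ) : Measure (Vec d) :=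
  ENNReal.ofReal (1 - ε) • F + ENNReal.ofReal ε • G

/-- The maximum bias `B(ε; PWS, F) = sup_G ‖PWS(F(ε, G)) - PWS(F)‖`, with values in `[0, ∞]`, where
`G` runs over the probability laws on `ℝ^d` at which `PWS(F(ε, G))` is well defined, and `N` is the
selected matrix norm. -/
def maxBias {d : ℕ} (N : Seminorm ℝ (Matrix (Fin d) (Fin d) ℝ)) (w₁ w₂ : ℝ → ℝ)
    (F : Measure (Vec d)) (ε : ℝ) : ℝ≥0∞ :=
  ⨆ (G : Measure (Vec d)) (_ : IsProbabilityMeasure G)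
    (_ : WellDefined w₁ w₂ (contaminate F G ε)),
    ENNReal.ofReal (N (pws w₁ w₂ (contaminate F G ε) - pws w₁ w₂ F))

/-- `e` is the asymptotic breakdown point of `PWS` at `F`: `e = min {ε : B(ε; PWS, F) = ∞}`. -/
def IsBreakdownPoint {d : ℕ} (N : Seminorm ℝ (Matrix (Fin d) (Fin d) ℝ)) (w₁ w₂ : ℝ → ℝ)
    (F : Measure (Vec d)) (e : ℝ) : Prop :=
  IsLeast {ε : ℝ | ε ∈ Icc (0 : ℝ) 1 ∧ maxBias N w₁ w₂ F ε = ⊤} e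

/-- `F` is elliptically symmetric about `θ` with the positive definite matrix `A` associated, and
`ν` is the law of the symmetric variable `Y`: for `X ∼ F` and every unit vector `u`, the variable
`u'(X - θ)` has the law of `√(u'Au) Y`. -/
structure IsElliptical {d : ℕ} (F : Measure (Vec d)) (θ : Vec d) (A : Matrix (Fin d) (Fin d) ℝ)
    (ν : Measure ℝ) : Prop where
  posDef : A.PosDef
  symm : ν.map (fun t => -t) = ν
  proj_eq : ∀ u : Vec d, ‖u‖ = 1 →
    F.map (fun x => inner ℝ u (x - θ)) =
      ν.map fun t => Real.sqrt (u.ofLp ⬝ᵥ (A *ᵥ u.ofLp)) * t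

end

end PDScatter

open PDScatter

/-! Everything rests on two bounds on a law `H`: a ball of radius `R` about `0` has mass more than
`1/2`, and every projection has `MAD` at least `c` (`ScaleControlled`). Then all projected medians
lie in `[-R, R]` and all `MAD`s in `[c, 2R]`. Testing the direction of `x` gives `‖x‖ * PD(x) ≤ 2R`,
so weights with `w₁(r) ≤ C r` and `w₂(r) ≤ C r²` absorb the growth of the integrands. On the ball
the depth is bounded below, which keeps the denominators away from zero. Hence `PWS(H)` is bounded
in terms of `R`, `c` and the weights (`exists_abs_pws_le`).

For `ε < 1/2` the component `(1 - ε) F` alone secures both bounds uniformly in `G`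
(`exists_scaleControlled_contaminate`): `F` is tight, and its projections put little mass on short
intervals, uniformly in direction and position.

At `ε = 1/2` take for `G` the translate of `F` by a long vector `v`. Projections of the mixture are
symmetric about `u'(θ + v/2)`, and their `MAD` is at least `|u'v|/4`; thus both centres `θ` and `θ +
v` have outlyingness at most `2`, however long `v` is. The weighted mean cannot be close to both
centres, so the points near one of them keep a fixed share of weight at a distance growing with `v`,
and a diagonal entry of `PWS` explodes (`exists_le_pws_translateMix`). -/

namespace PDScatter

/-! ### Medians and median absolute deviations on the line. -/

section Median

variable {ν : Measure ℝ} [IsProbabilityMeasure ν]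

theorem exists_half_lt_real_Icc (ν : Measure ℝ) [IsProbabilityMeasure ν] :
    ∃ a b : ℝ, 1 / 2 < ν.real (Icc a b) := by
  have h : Tendsto (fun n : ℕ => ν (Icc (-(n : ℝ)) n)) atTop (𝓝 (ν (⋃ n : ℕ, Icc (-(n : ℝ)) n))) := by
    apply tendsto_measure_iUnion_atTop
    intro m n hmn
    have : (m : ℝ) ≤ n := by exact_mod_cast hmn
    exact Icc_subset_Icc (by linarith) this
  have hU : (⋃ n : ℕ, Icc (-(n : ℝ)) n) = univ := by
    refine eq_univ_of_forall fun x => mem_iUnion.2 ?_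
    obtain ⟨n, hn⟩ := exists_nat_ge |x|
    exact ⟨n, abs_le.1 hn⟩
  rw [hU, measure_univ] at h
  have h' := (ENNReal.tendsto_toReal ENNReal.one_ne_top).comp h
  obtain ⟨n, hn⟩ := (h'.eventually (lt_mem_nhds (show (1 / 2 : ℝ) < (1 : ℝ≥0∞).toReal by norm_num))).exists
  exact ⟨_, _, hn⟩

theorem le_of_half_le_real_Iic {a b t : ℝ} (h : 1 / 2 < ν.real (Icc a b))
    (ht : 1 / 2 ≤ ν.real (Iic t)) : a ≤ t := by
  by_contra! hlt
  have hd : Disjoint (Iic t) (Icc a b) := by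
    rw [Set.disjoint_left]; intro x hx hx'; exact absurd (hx'.1.trans hx) (not_le.2 hlt)
  have h1 := measureReal_union (μ := ν) hd measurableSet_Icc
  have h2 : ν.real (Iic t ∪ Icc a b) ≤ 1 := measureReal_le_one
  linarith

theorem le_of_half_le_real_Ici {a b t : ℝ} (h : 1 / 2 < ν.real (Icc a b))
    (ht : 1 / 2 ≤ ν.real (Ici t)) : t ≤ b := by
  by_contra! hlt
  have hd : Disjoint (Ici t) (Icc a b) := by
    rw [Set.disjoint_left]; intro x hx hx'; exact absurd (le_trans hx hx'.2) (not_le.2 hlt)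
  have h1 := measureReal_union (μ := ν) hd measurableSet_Icc
  have h2 : ν.real (Ici t ∪ Icc a b) ≤ 1 := measureReal_le_one
  linarith

theorem half_le_real_Iic {a b : ℝ} (h : 1 / 2 < ν.real (Icc a b)) : 1 / 2 ≤ ν.real (Iic b) :=
  h.le.trans (measureReal_mono fun _ hx => hx.2)

theorem half_le_real_Ici {a b : ℝ} (h : 1 / 2 < ν.real (Icc a b)) : 1 / 2 ≤ ν.real (Ici a) :=
  h.le.trans (measureReal_mono fun _ hx => hx.1)

theorem nonempty_lowerMedianSet (ν : Measure ℝ) [IsProbabilityMeasure ν] :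
    {t : ℝ | 1 / 2 ≤ ν.real (Iic t)}.Nonempty :=
  let ⟨_, b, h⟩ := exists_half_lt_real_Icc ν
  ⟨b, half_le_real_Iic h⟩

theorem bddBelow_lowerMedianSet (ν : Measure ℝ) [IsProbabilityMeasure ν] :
    BddBelow {t : ℝ | 1 / 2 ≤ ν.real (Iic t)} :=
  let ⟨a, _, h⟩ := exists_half_lt_real_Icc ν
  ⟨a, fun _ ht => le_of_half_le_real_Iic h ht⟩

theorem nonempty_upperMedianSet (ν : Measure ℝ) [IsProbabilityMeasure ν] :
    {t : ℝ | 1 / 2 ≤ ν.real (Ici t)}.Nonempty :=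
  let ⟨a, _, h⟩ := exists_half_lt_real_Icc ν
  ⟨a, half_le_real_Ici h⟩

theorem bddAbove_upperMedianSet (ν : Measure ℝ) [IsProbabilityMeasure ν] :
    BddAbove {t : ℝ | 1 / 2 ≤ ν.real (Ici t)} :=
  let ⟨_, b, h⟩ := exists_half_lt_real_Icc ν
  ⟨b, fun _ ht => le_of_half_le_real_Ici h ht⟩

theorem median_mem_Icc {a b : ℝ} (h : 1 / 2 < ν.real (Icc a b)) : median ν ∈ Icc a b := by
  have h1 : a ≤ sInf {t : ℝ | 1 / 2 ≤ ν.real (Iic t)} :=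
    le_csInf (nonempty_lowerMedianSet ν) fun t ht => le_of_half_le_real_Iic h ht
  have h2 : sInf {t : ℝ | 1 / 2 ≤ ν.real (Iic t)} ≤ b :=
    csInf_le (bddBelow_lowerMedianSet ν) (half_le_real_Iic h)
  have h3 : a ≤ sSup {t : ℝ | 1 / 2 ≤ ν.real (Ici t)} :=
    le_csSup (bddAbove_upperMedianSet ν) (half_le_real_Ici h)
  have h4 : sSup {t : ℝ | 1 / 2 ≤ ν.real (Ici t)} ≤ b :=
    csSup_le (nonempty_upperMedianSet ν) fun t ht => le_of_half_le_real_Ici h ht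
  constructor <;> unfold median <;> linarith

theorem le_median {s : ℝ} (h : ν.real (Iic s) < 1 / 2) : s ≤ median ν := by
  have h1 : s ≤ sInf {t : ℝ | 1 / 2 ≤ ν.real (Iic t)} := by
    refine le_csInf (nonempty_lowerMedianSet ν) fun t ht => ?_
    by_contra! hlt
    have : ν.real (Iic t) ≤ ν.real (Iic s) := measureReal_mono (Iic_subset_Iic.2 hlt.le)
    have ht' : 1 / 2 ≤ ν.real (Iic t) := ht
    linarith
  have h2 : s ≤ sSup {t : ℝ | 1 / 2 ≤ ν.real (Ici t)} := by
    refine le_csSup (bddAbove_upperMedianSet ν) ?_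
    have h3 : ν.real (Iic s)ᶜ = 1 - ν.real (Iic s) := probReal_compl_eq_one_sub measurableSet_Iic
    have h4 : ν.real (Iic s)ᶜ ≤ ν.real (Ici s) := measureReal_mono fun x hx => (not_le.1 (mem_compl_iff _ _ |>.1 hx) : s < x).le
    show 1 / 2 ≤ ν.real (Ici s)
    linarith
  unfold median; linarith

/-- Only the upper median is known to reach `s`; the lower one is merely nonnegative, so the
midpoint convention costs a factor `2`. -/
theorem half_le_median {s : ℝ} (h0 : ν (Iio 0) = 0) (h : 1 / 2 ≤ ν.real (Ici s)) :
    s / 2 ≤ median ν := by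
  have h1 : 0 ≤ sInf {t : ℝ | 1 / 2 ≤ ν.real (Iic t)} := by
    refine le_csInf (nonempty_lowerMedianSet ν) fun t ht => ?_
    by_contra! hlt
    have h2 : ν.real (Iic t) ≤ ν.real (Iio 0) := measureReal_mono fun x hx => lt_of_le_of_lt hx hlt
    have h3 : ν.real (Iio 0) = 0 := by simp [measureReal_def, h0]
    have ht' : 1 / 2 ≤ ν.real (Iic t) := ht
    linarith
  have h2 : s ≤ sSup {t : ℝ | 1 / 2 ≤ ν.real (Ici t)} := le_csSup (bddAbove_upperMedianSet ν) h
  unfold median; linarith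

/-- A reflection interchanges the lower and the upper median, so their midpoint is equivariant. This
locates the median of a symmetric law without any uniqueness of medians. -/
theorem median_map_const_sub (ν : Measure ℝ) [IsProbabilityMeasure ν] (c : ℝ) :
    median (ν.map fun t => c - t) = c - median ν := by
  have hm : Measurable fun t : ℝ => c - t := by fun_prop
  have h1 : ∀ t, (ν.map fun t => c - t).real (Iic t) = ν.real (Ici (c - t)) := by
    intro t
    rw [map_measureReal_apply hm measurableSet_Iic]
    congr 1; ext x; simp only [mem_preimage, mem_Iic, mem_Ici]; constructor <;> intro <;> linarith
  have h2 : ∀ t, (ν.map fun t => c - t).real (Ici t) = ν.real (Iic (c - t)) := by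
    intro t
    rw [map_measureReal_apply hm measurableSet_Ici]
    congr 1; ext x; simp only [mem_preimage, mem_Iic, mem_Ici]; constructor <;> intro <;> linarith
  have h3 : IsGLB {t : ℝ | 1 / 2 ≤ ν.real (Ici (c - t))}
      (c - sSup {t : ℝ | 1 / 2 ≤ ν.real (Ici t)}) := by
    constructor
    · intro t ht
      have := le_csSup (bddAbove_upperMedianSet ν) ht
      linarith
    · intro b hb
      have : sSup {t : ℝ | 1 / 2 ≤ ν.real (Ici t)} ≤ c - b := by
        refine csSup_le (nonempty_upperMedianSet ν) fun t ht => ?_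
        have : b ≤ c - t := hb (by simpa using ht)
        linarith
      linarith
  have h4 : IsLUB {t : ℝ | 1 / 2 ≤ ν.real (Iic (c - t))}
      (c - sInf {t : ℝ | 1 / 2 ≤ ν.real (Iic t)}) := by
    constructor
    · intro t ht
      have := csInf_le (bddBelow_lowerMedianSet ν) ht
      linarith
    · intro b hb
      have : c - b ≤ sInf {t : ℝ | 1 / 2 ≤ ν.real (Iic t)} := by
        refine le_csInf (nonempty_lowerMedianSet ν) fun t ht => ?_
        have : c - t ≤ b := hb (by simpa using ht)
        linarith
      linarith
  obtain ⟨a, ha⟩ := nonempty_upperMedianSet ν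
  obtain ⟨b, hb⟩ := nonempty_lowerMedianSet ν
  have h5 := h3.csInf_eq ⟨c - a, by simpa using ha⟩
  have h6 := h4.csSup_eq ⟨c - b, by simpa using hb⟩
  simp only [median, h1, h2, h5, h6]
  ring

theorem median_eq_of_map_eq {c : ℝ} (h : (ν.map fun t => 2 * c - t) = ν) : median ν = c := by
  have h1 := median_map_const_sub ν (2 * c)
  rw [h] at h1
  linarith

theorem measurable_abs_sub (m : ℝ) : Measurable fun t : ℝ => |t - m| := by fun_prop

theorem mad_le {R : ℝ} (h : 1 / 2 < ν.real (Icc (-R) R)) : mad ν ≤ 2 * R := by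
  have hm := median_mem_Icc h
  have := Measure.isProbabilityMeasure_map (μ := ν) (measurable_abs_sub (median ν)).aemeasurable
  refine (median_mem_Icc (a := 0) (h.trans_le ?_)).2
  rw [map_measureReal_apply (measurable_abs_sub _) measurableSet_Icc]
  refine measureReal_mono fun t ht => ⟨abs_nonneg _, abs_le.2 ?_⟩
  constructor <;> linarith [hm.1, hm.2, ht.1, ht.2]

/-- Quantifying over all centres `m` avoids having to know where the median is. -/
theorem le_mad {s : ℝ} (h : ∀ m, ν.real (Metric.closedBall m s) < 1 / 2) : s ≤ mad ν := by
  have := Measure.isProbabilityMeasure_map (μ := ν) (measurable_abs_sub (median ν)).aemeasurable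
  refine le_median ?_
  rw [map_measureReal_apply (measurable_abs_sub _) measurableSet_Iic]
  exact h (median ν)

theorem half_le_mad {s : ℝ} (h : 1 / 2 ≤ ν.real {t | s ≤ |t - median ν|}) : s / 2 ≤ mad ν := by
  have := Measure.isProbabilityMeasure_map (μ := ν) (measurable_abs_sub (median ν)).aemeasurable
  refine half_le_median ?_ ?_
  · rw [Measure.map_apply (measurable_abs_sub _) measurableSet_Iio]
    convert measure_empty (μ := ν)
    ext t; simp
  · rw [map_measureReal_apply (measurable_abs_sub _) measurableSet_Ici]
    exact h

end Median

/-! ### Growth and positivity of the weight functions. -/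

section Weight

theorem weight_le_mul {w : ℝ → ℝ} (hd : DifferentiableOn ℝ w (Icc 0 1))
    (hc : ContinuousOn (derivWithin w (Icc 0 1)) (Icc 0 1)) (h0 : w 0 = 0) :
    ∃ C, 0 < C ∧ ∀ r ∈ Icc (0 : ℝ) 1, w r ≤ C * r := by
  obtain ⟨C, hC⟩ := isCompact_Icc.exists_bound_of_continuousOn hc
  refine ⟨max C 1, by positivity, fun r hr => ?_⟩
  have h := (convex_Icc (0 : ℝ) 1).norm_image_sub_le_of_norm_derivWithin_le hd hC
    (left_mem_Icc.2 zero_le_one) hr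
  rw [h0, sub_zero, sub_zero, Real.norm_of_nonneg hr.1] at h
  exact (le_abs_self _).trans (h.trans (mul_le_mul_of_nonneg_right (le_max_left _ _) hr.1))

/-- The derivative vanishes at `0` and is Lipschitz, hence is at most `K r` in absolute value on
`[0, r]`; the mean value inequality supplies the second factor `r`. -/
theorem weight_le_mul_sq {w : ℝ → ℝ} (hd : DifferentiableOn ℝ w (Icc 0 1))
    (hl : ∃ K : ℝ≥0, LipschitzOnWith K (derivWithin w (Icc 0 1)) (Icc 0 1))
    (hO : derivWithin w (Icc 0 1) =O[𝓝[≥] (0 : ℝ)] fun r : ℝ => r ^ 2) (h0 : w 0 = 0) :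
    ∃ C, 0 < C ∧ ∀ r ∈ Icc (0 : ℝ) 1, w r ≤ C * r ^ 2 := by
  obtain ⟨K, hK⟩ := hl
  obtain ⟨c, hc⟩ := hO.bound
  -- The filter `𝓝[≥] 0` contains the point `0` itself, so the bound can be evaluated there.
  have hz : derivWithin w (Icc 0 1) 0 = 0 := by
    have := hc.self_of_nhdsWithin (by simp : (0 : ℝ) ∈ Ici 0)
    simpa using this
  refine ⟨K + 1, by positivity, fun r hr => ?_⟩
  have hsub : Icc 0 r ⊆ Icc (0 : ℝ) 1 := Icc_subset_Icc_right hr.2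
  have h := (convex_Icc (0 : ℝ) r).norm_image_sub_le_of_norm_hasDerivWithin_le (C := K * r)
    (fun x hx => ((hd x (hsub hx)).hasDerivWithinAt).mono hsub)
    (fun x hx => by
      have := hK.dist_le_mul x (hsub hx) 0 (left_mem_Icc.2 zero_le_one)
      rw [Real.dist_eq, Real.dist_eq, hz, sub_zero, sub_zero, abs_of_nonneg hx.1] at this
      exact this.trans (mul_le_mul_of_nonneg_left hx.2 K.2))
    (left_mem_Icc.2 hr.1) (right_mem_Icc.2 hr.1)
  rw [h0, sub_zero, sub_zero, Real.norm_of_nonneg hr.1] at h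
  have h2 := (le_abs_self _).trans h
  nlinarith [sq_nonneg r]

theorem exists_pos_le_weight {w : ℝ → ℝ} (hc : ContinuousOn w (Icc 0 1))
    (hw : ∀ r ∈ Ioc (0 : ℝ) 1, 0 < w r) {r₀ : ℝ} (hr₀ : 0 < r₀) :
    ∃ κ, 0 < κ ∧ ∀ r ∈ Icc r₀ 1, κ ≤ w r := by
  have hsub : Icc r₀ 1 ⊆ Icc 0 1 := Icc_subset_Icc_left hr₀.le
  obtain h | h := (Icc r₀ (1 : ℝ)).eq_empty_or_nonempty
  · exact ⟨1, one_pos, by simp [h]⟩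
  · obtain ⟨x, hx, hmin⟩ := isCompact_Icc.exists_isMinOn h (hc.mono hsub)
    exact ⟨w x, hw x ⟨hr₀.trans_le hx.1, hx.2⟩, fun r hr => hmin hr⟩

end Weight

/-! ### Comparison of an arbitrary matrix norm with the entries. -/

theorem exists_le_seminorm {E : Type*} [AddCommGroup E] [Module ℝ E] [FiniteDimensional ℝ E]
    (N : Seminorm ℝ E) (hN : ∀ x, N x = 0 → x = 0) (f : E →ₗ[ℝ] ℝ) :
    ∃ C, 0 < C ∧ ∀ x, |f x| ≤ C * N x := by
  -- With trivial kernel `N` is a norm, and in finite dimension every linear functional is bounded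
  -- with respect to it.
  let : Norm E := ⟨N⟩
  have core : NormedSpace.Core ℝ E :=
    { norm_nonneg := fun x => apply_nonneg N x
      norm_smul := fun c x => map_smul_eq_mul N c x
      norm_triangle := fun x y => map_add_le_add N x y
      norm_eq_zero_iff := fun x => ⟨hN x, fun h => h ▸ map_zero N⟩ }
  let := NormedAddCommGroup.ofCore core
  let : NormedSpace ℝ E := NormedSpace.ofCore core
  obtain ⟨C, hC, h⟩ := (LinearMap.toContinuousLinearMap f).bound
  exact ⟨C, hC, h⟩

theorem seminorm_matrix_le {d : ℕ} (N : Seminorm ℝ (Matrix (Fin d) (Fin d) ℝ)) :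
    ∃ C, 0 ≤ C ∧ ∀ (M : Matrix (Fin d) (Fin d) ℝ) (B : ℝ), (∀ i j, |M i j| ≤ B) → N M ≤ C * B := by
  refine ⟨∑ i, ∑ j, N (Matrix.single i j 1), by positivity, fun M B hB => ?_⟩
  conv_lhs => rw [M.matrix_eq_sum_single]
  rw [Finset.sum_mul]
  refine (Finset.le_sum_of_subadditive N (map_zero N).le (map_add_le_add N) _ _).trans (Finset.sum_le_sum fun i _ => ?_)
  rw [Finset.sum_mul]
  refine (Finset.le_sum_of_subadditive N (map_zero N).le (map_add_le_add N) _ _).trans (Finset.sum_le_sum fun j _ => ?_)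
  have : Matrix.single i j (M i j) = M i j • Matrix.single i j (1 : ℝ) := by
    rw [Matrix.smul_single, smul_eq_mul, mul_one]
  rw [this, map_smul_eq_mul, mul_comm]
  exact mul_le_mul_of_nonneg_left (hB i j) (apply_nonneg N _)

/-! ### Outlyingness and depth of a scale-controlled law. -/

section Depth

/-- `H` puts more than half of its mass on the ball of radius `R` about `0`, and all its projections
have a median absolute deviation at least `c`. -/
structure ScaleControlled {d : ℕ} (H : Measure (Vec d)) (R c : ℝ) : Prop where
  radius_pos : 0 < R
  scale_pos : 0 < c
  half_lt : 1 / 2 < H.real (Metric.closedBall 0 R)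
  le_mad : ∀ u : Vec d, ‖u‖ = 1 → c ≤ mad (proj H u)

variable {d : ℕ} {H : Measure (Vec d)} {R c : ℝ}

theorem measurable_inner_left (u : Vec d) : Measurable fun x : Vec d => inner ℝ u x := by fun_prop

instance [IsProbabilityMeasure H] (u : Vec d) : IsProbabilityMeasure (proj H u) :=
  Measure.isProbabilityMeasure_map (measurable_inner_left u).aemeasurable

theorem proj_real_apply (H : Measure (Vec d)) (u : Vec d) {s : Set ℝ} (hs : MeasurableSet s) :
    (proj H u).real s = H.real ((fun x => inner ℝ u x) ⁻¹' s) :=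
  map_measureReal_apply (measurable_inner_left u) hs

theorem median_proj_neg (H : Measure (Vec d)) [IsProbabilityMeasure H] (u : Vec d) :
    median (proj H (-u)) = -median (proj H u) := by
  have h : proj H (-u) = (proj H u).map fun t => 0 - t := by
    rw [proj, proj, Measure.map_map (by fun_prop) (by fun_prop)]
    congr 1; ext x; simp
  rw [h, median_map_const_sub, zero_sub]

namespace ScaleControlled

theorem mad_pos (hH : ScaleControlled H R c) {u : Vec d} (hu : ‖u‖ = 1) : 0 < mad (proj H u) :=
  hH.scale_pos.trans_le (hH.le_mad u hu)

theorem outlyingness_le [NeZero d] {x : Vec d} {B : ℝ} (h : ∀ u : Vec d, ‖u‖ = 1 →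
    (inner ℝ u x - median (proj H u)) / mad (proj H u) ≤ B) : outlyingness x H ≤ B := by
  refine csSup_le ?_ ?_
  · exact (NormedSpace.sphere_nonempty.2 zero_le_one).image _
  · rintro _ ⟨u, hu, rfl⟩
    exact h u (by simpa using hu)

variable [IsProbabilityMeasure H]

theorem half_lt_proj (hH : ScaleControlled H R c)
    {u : Vec d} (hu : ‖u‖ = 1) : 1 / 2 < (proj H u).real (Icc (-R) R) := by
  rw [proj_real_apply _ _ measurableSet_Icc]
  refine hH.half_lt.trans_le (measureReal_mono fun x hx => ?_)
  have h1 : ‖x‖ ≤ R := by simpa using hx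
  have h2 := abs_real_inner_le_norm u x
  rw [hu, one_mul] at h2
  exact abs_le.1 (h2.trans h1)

theorem abs_median_le (hH : ScaleControlled H R c)
    {u : Vec d} (hu : ‖u‖ = 1) : |median (proj H u)| ≤ R :=
  abs_le.2 (median_mem_Icc (hH.half_lt_proj hu))

theorem ratio_le (hH : ScaleControlled H R c) {u : Vec d} (hu : ‖u‖ = 1) (x : Vec d) :
    (inner ℝ u x - median (proj H u)) / mad (proj H u) ≤ (‖x‖ + R) / c := by
  have h1 := real_inner_le_norm u x
  rw [hu, one_mul] at h1
  have h2 := (abs_le.1 (hH.abs_median_le hu)).1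
  have h3 := hH.radius_pos
  exact div_le_div₀ (by positivity) (by linarith) hH.scale_pos (hH.le_mad u hu)

theorem bddAbove_ratio (hH : ScaleControlled H R c) (x : Vec d) :
    BddAbove ((fun u : Vec d => (inner ℝ u x - median (proj H u)) / mad (proj H u)) ''
      Metric.sphere (0 : Vec d) 1) := by
  refine ⟨(‖x‖ + R) / c, ?_⟩
  rintro _ ⟨u, hu, rfl⟩
  exact hH.ratio_le (by simpa using hu) x

theorem le_outlyingness (hH : ScaleControlled H R c) {u : Vec d} (hu : ‖u‖ = 1) (x : Vec d) :
    (inner ℝ u x - median (proj H u)) / mad (proj H u) ≤ outlyingness x H :=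
  le_csSup (hH.bddAbove_ratio x) ⟨u, by simpa using hu, rfl⟩

variable [NeZero d]

/-- The projected median is odd in `u`, so the ratios for `u` and `-u` have numerators of opposite
sign. -/
theorem outlyingness_nonneg (hH : ScaleControlled H R c) (x : Vec d) : 0 ≤ outlyingness x H := by
  obtain ⟨u, hu⟩ : ∃ u : Vec d, ‖u‖ = 1 := exists_norm_eq _ zero_le_one
  have hu' : ‖-u‖ = 1 := by rwa [norm_neg]
  obtain h | h := le_total 0 (inner ℝ u x - median (proj H u))
  · exact (div_nonneg h (hH.mad_pos hu).le).trans (hH.le_outlyingness hu x)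
  · refine (div_nonneg ?_ (hH.mad_pos hu').le).trans (hH.le_outlyingness hu' x)
    rw [median_proj_neg, inner_neg_left]; linarith

/-- For `‖x‖ > R` use the direction `x / ‖x‖`, where the median is at most `R` and the `MAD` at most
`2R`; for smaller `x` the left side is at most `1`. -/
theorem one_add_outlyingness_ge (hH : ScaleControlled H R c)
    (x : Vec d) : (‖x‖ + R) / (2 * R) ≤ 1 + outlyingness x H := by
  have hR := hH.radius_pos
  obtain h | h := le_total ‖x‖ R
  · have h1 := hH.outlyingness_nonneg x
    have h2 : (‖x‖ + R) / (2 * R) ≤ 1 := by rw [div_le_one (by positivity)]; linarith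
    linarith
  · have hx : 0 < ‖x‖ := hR.trans_le h
    set u : Vec d := ‖x‖⁻¹ • x with hu_def
    have hu : ‖u‖ = 1 := by
      rw [hu_def, norm_smul, norm_inv, norm_norm, inv_mul_cancel₀ hx.ne']
    have h1 : inner ℝ u x = ‖x‖ := by
      rw [hu_def, real_inner_smul_left, real_inner_self_eq_norm_sq]; field_simp
    have h2 := hH.le_outlyingness hu x
    rw [h1] at h2
    have h3 := (abs_le.1 (hH.abs_median_le hu)).2
    have h4 : (‖x‖ - R) / (2 * R) ≤ (‖x‖ - median (proj H u)) / mad (proj H u) :=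
      div_le_div₀ (by linarith) (by linarith) (hH.mad_pos hu) (mad_le (hH.half_lt_proj hu))
    have h5 : (‖x‖ + R) / (2 * R) = 1 + (‖x‖ - R) / (2 * R) := by field_simp; ring
    linarith

/-- A supremum of functions that are Lipschitz with constant `1/c`. The constant does not involve
`R`, which matters when `R` grows with the contamination. -/
theorem outlyingness_le_add (hH : ScaleControlled H R c) (x y : Vec d) :
    outlyingness x H ≤ outlyingness y H + c⁻¹ * ‖x - y‖ := by
  refine outlyingness_le fun u hu => ?_
  have h1 := hH.le_outlyingness hu y
  have h2 : (inner ℝ u x - median (proj H u)) / mad (proj H u) =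
      (inner ℝ u y - median (proj H u)) / mad (proj H u) + inner ℝ u (x - y) / mad (proj H u) := by
    rw [inner_sub_right]; ring
  have h3 := real_inner_le_norm u (x - y)
  rw [hu, one_mul] at h3
  have h4 : inner ℝ u (x - y) / mad (proj H u) ≤ ‖x - y‖ / c :=
    div_le_div₀ (norm_nonneg _) h3 hH.scale_pos (hH.le_mad u hu)
  rw [h2, inv_mul_eq_div]; linarith

theorem continuous_outlyingness (hH : ScaleControlled H R c)
    : Continuous fun x => outlyingness x H := by
  have hc := inv_nonneg.2 hH.scale_pos.le
  refine (LipschitzWith.of_le_add_mul ⟨c⁻¹, hc⟩ fun x y => ?_).continuous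
  rw [dist_eq_norm]
  exact hH.outlyingness_le_add x y

theorem one_add_outlyingness_pos (hH : ScaleControlled H R c)
    (x : Vec d) : 0 < 1 + outlyingness x H := by
  linarith [hH.outlyingness_nonneg x]

theorem continuous_projectionDepth (hH : ScaleControlled H R c)
    : Continuous fun x => projectionDepth x H :=
  continuous_const.div (continuous_const.add hH.continuous_outlyingness)
    fun x => (hH.one_add_outlyingness_pos x).ne'

theorem projectionDepth_pos (hH : ScaleControlled H R c) (x : Vec d) : 0 < projectionDepth x H :=
  one_div_pos.2 (hH.one_add_outlyingness_pos x)

theorem projectionDepth_le_one (hH : ScaleControlled H R c)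
    (x : Vec d) : projectionDepth x H ≤ 1 := by
  rw [projectionDepth, div_le_one (hH.one_add_outlyingness_pos x)]
  linarith [hH.outlyingness_nonneg x]

theorem projectionDepth_mem (hH : ScaleControlled H R c)
    (x : Vec d) : projectionDepth x H ∈ Icc (0 : ℝ) 1 :=
  ⟨(hH.projectionDepth_pos x).le, hH.projectionDepth_le_one x⟩

theorem norm_mul_projectionDepth_le (hH : ScaleControlled H R c)
    (x : Vec d) : ‖x‖ * projectionDepth x H ≤ 2 * R := by
  have hR := hH.radius_pos
  have h := hH.one_add_outlyingness_ge x
  rw [projectionDepth, mul_one_div, div_le_iff₀ (hH.one_add_outlyingness_pos x)]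
  rw [div_le_iff₀ (by positivity)] at h
  linarith

theorem projectionDepth_ge (hH : ScaleControlled H R c)
    {x : Vec d} {B : ℝ} (h : outlyingness x H ≤ B) :
    1 / (1 + B) ≤ projectionDepth x H :=
  one_div_le_one_div_of_le (hH.one_add_outlyingness_pos x) (by linarith)

theorem projectionDepth_ge_of_norm_le (hH : ScaleControlled H R c) {x : Vec d} (hx : ‖x‖ ≤ R) :
    1 / (1 + 2 * R / c) ≤ projectionDepth x H := by
  refine hH.projectionDepth_ge (outlyingness_le fun u hu => (hH.ratio_le hu x).trans ?_)
  exact div_le_div_of_nonneg_right (by linarith) hH.scale_pos.le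

end ScaleControlled

end Depth

/-! ### Bounds for the weighted mean and scatter. -/

section Functional

/-- A continuous weight on `[0, 1]`, positive on `(0, 1]`, at most `C r ^ k` at `r`. -/
structure IsWeight (w : ℝ → ℝ) (k : ℕ) (C : ℝ) : Prop where
  continuousOn : ContinuousOn w (Icc 0 1)
  pos : ∀ r ∈ Ioc (0 : ℝ) 1, 0 < w r
  const_pos : 0 < C
  le_mul_pow : ∀ r ∈ Icc (0 : ℝ) 1, w r ≤ C * r ^ k

variable {d : ℕ} [NeZero d] {H : Measure (Vec d)} [IsProbabilityMeasure H] {R c : ℝ}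
  {w : ℝ → ℝ} {k : ℕ} {C : ℝ}

namespace ScaleControlled

theorem continuous_weight (hH : ScaleControlled H R c) (hw : IsWeight w k C)
    : Continuous fun x => w (projectionDepth x H) :=
  hw.continuousOn.comp_continuous hH.continuous_projectionDepth hH.projectionDepth_mem

theorem weight_pos (hH : ScaleControlled H R c) (hw : IsWeight w k C)
    (x : Vec d) : 0 < w (projectionDepth x H) :=
  hw.pos _ ⟨hH.projectionDepth_pos x, hH.projectionDepth_le_one x⟩

theorem weight_le (hH : ScaleControlled H R c) (hw : IsWeight w k C)
    (x : Vec d) : w (projectionDepth x H) ≤ C := by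
  have hm := hH.projectionDepth_mem x
  refine (hw.le_mul_pow _ hm).trans ?_
  have := pow_le_one₀ hm.1 hm.2 (n := k)
  have := hw.const_pos
  nlinarith

theorem norm_pow_mul_weight_le (hH : ScaleControlled H R c) (hw : IsWeight w k C) (x : Vec d) :
    ‖x‖ ^ k * w (projectionDepth x H) ≤ C * (2 * R) ^ k := by
  have hm := hH.projectionDepth_mem x
  calc ‖x‖ ^ k * w (projectionDepth x H) ≤ ‖x‖ ^ k * (C * projectionDepth x H ^ k) := by
        gcongr; exact hw.le_mul_pow _ hm
    _ = C * (‖x‖ * projectionDepth x H) ^ k := by rw [mul_pow]; ring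
    _ ≤ C * (2 * R) ^ k := by
        have := hw.const_pos
        have h0 := mul_nonneg (norm_nonneg x) hm.1
        exact mul_le_mul_of_nonneg_left
          (pow_le_pow_left₀ h0 (hH.norm_mul_projectionDepth_le x) k) this.le

theorem integrable_weight (hH : ScaleControlled H R c) (hw : IsWeight w k C)
    : Integrable (fun x => w (projectionDepth x H)) H := by
  refine Integrable.of_bound (hH.continuous_weight hw).aestronglyMeasurable C (.of_forall fun x => ?_)
  rw [Real.norm_of_nonneg (hH.weight_pos hw x).le]
  exact hH.weight_le hw x

theorem integrable_norm_pow_mul_weight (hH : ScaleControlled H R c) (hw : IsWeight w k C) :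
    Integrable (fun x => ‖x‖ ^ k * w (projectionDepth x H)) H := by
  have hc := hH.continuous_weight hw
  refine Integrable.of_bound
    ((by fun_prop : Continuous fun x : Vec d => ‖x‖ ^ k).mul hc).aestronglyMeasurable
    (C * (2 * R) ^ k) (.of_forall fun x => ?_)
  rw [Real.norm_of_nonneg (mul_nonneg (by positivity) (hH.weight_pos hw x).le)]
  exact hH.norm_pow_mul_weight_le hw x

theorem integral_weight_le (hH : ScaleControlled H R c) (hw : IsWeight w k C)
    : ∫ x, w (projectionDepth x H) ∂H ≤ C := by
  have := integral_mono (hH.integrable_weight hw) (integrable_const C) (hH.weight_le hw)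
  simpa using this

theorem half_mul_le_integral_weight (hH : ScaleControlled H R c) (hw : IsWeight w k C)
    {κ : ℝ} (hκ : ∀ r ∈ Icc (1 / (1 + 2 * R / c)) 1, κ ≤ w r)
    (hκ0 : 0 < κ) : κ / 2 ≤ ∫ x, w (projectionDepth x H) ∂H := by
  have h1 : κ * H.real (Metric.closedBall 0 R) ≤
      ∫ x in Metric.closedBall 0 R, w (projectionDepth x H) ∂H := by
    refine setIntegral_ge_of_const_le_real Metric.isClosed_closedBall.measurableSet
      (measure_ne_top _ _) (fun x hx => hκ _ ⟨hH.projectionDepth_ge_of_norm_le (by simpa using hx),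
        hH.projectionDepth_le_one x⟩) (hH.integrable_weight hw).integrableOn
  have h2 := setIntegral_le_integral (s := Metric.closedBall 0 R) (hH.integrable_weight hw)
    (.of_forall fun x => (hH.weight_pos hw x).le)
  have := hH.half_lt
  nlinarith

end ScaleControlled

variable {w₁ w₂ : ℝ → ℝ} {C₁ C₂ : ℝ}

theorem ScaleControlled.wellDefined (hH : ScaleControlled H R c) (hw₁ : IsWeight w₁ 1 C₁)
    (hw₂ : IsWeight w₂ 2 C₂) : WellDefined w₁ w₂ H := by
  have hr : 0 < 1 / (1 + 2 * R / c) := by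
    have := hH.radius_pos
    have := hH.scale_pos
    positivity
  obtain ⟨κ₁, hκ₁, h₁⟩ := exists_pos_le_weight hw₁.continuousOn hw₁.pos hr
  obtain ⟨κ₂, hκ₂, h₂⟩ := exists_pos_le_weight hw₂.continuousOn hw₂.pos hr
  exact
    { mad_pos := fun u hu => hH.mad_pos hu
      outlyingness_finite := hH.bddAbove_ratio
      mass_pos₁ := (half_pos hκ₁).trans_le (hH.half_mul_le_integral_weight hw₁ h₁ hκ₁)
      mass_pos₂ := (half_pos hκ₂).trans_le (hH.half_mul_le_integral_weight hw₂ h₂ hκ₂)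
      moment₁ := by simpa using hH.integrable_norm_pow_mul_weight hw₁
      moment₂ := hH.integrable_norm_pow_mul_weight hw₂ }

theorem ScaleControlled.norm_depthMean_le (hH : ScaleControlled H R c) (hw : IsWeight w 1 C)
    {κ : ℝ} (hκ : ∀ r ∈ Icc (1 / (1 + 2 * R / c)) 1, κ ≤ w r) (hκ0 : 0 < κ) :
    ‖depthMean w H‖ ≤ C * (2 * R) / (κ / 2) := by
  have h1 := hH.half_mul_le_integral_weight hw hκ hκ0
  have h2 : ‖∫ x, w (projectionDepth x H) • x ∂H‖ ≤ C * (2 * R) := by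
    have := norm_integral_le_of_norm_le_const (μ := H) (C := C * (2 * R))
      (f := fun x => w (projectionDepth x H) • x) (.of_forall fun x => by
        rw [norm_smul, Real.norm_of_nonneg (hH.weight_pos hw x).le, mul_comm]
        simpa using hH.norm_pow_mul_weight_le hw x)
    simpa using this
  rw [depthMean, norm_smul, norm_inv, Real.norm_of_nonneg (by linarith), inv_mul_eq_div]
  exact div_le_div₀ (by have := hH.radius_pos; have := hw.const_pos; positivity) h2
    (half_pos hκ0) h1

theorem ScaleControlled.abs_integrand_le (hH : ScaleControlled H R c) (hw : IsWeight w 2 C)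
    {L : Vec d} {l : ℝ} (hL : ‖L‖ ≤ l) (i j : Fin d) (x : Vec d) :
    |(x i - L i) * (x j - L j) * w (projectionDepth x H)| ≤ 2 * C * ((2 * R) ^ 2 + l ^ 2) := by
  have hi : |x i - L i| ≤ ‖x - L‖ := by simpa using PiLp.norm_apply_le (x - L) i
  have hj : |x j - L j| ≤ ‖x - L‖ := by simpa using PiLp.norm_apply_le (x - L) j
  have h1 : ‖x - L‖ ≤ ‖x‖ + l := (norm_sub_le _ _).trans (by linarith)
  have hw0 := (hH.weight_pos hw x).le
  have h2 := hH.norm_pow_mul_weight_le hw x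
  have h3 := hH.weight_le hw x
  rw [abs_mul, abs_mul, abs_of_nonneg hw0]
  calc |x i - L i| * |x j - L j| * w (projectionDepth x H)
      ≤ (‖x‖ + l) * (‖x‖ + l) * w (projectionDepth x H) := by
        have h0 : 0 ≤ ‖x‖ + l := add_nonneg (norm_nonneg x) ((norm_nonneg L).trans hL)
        gcongr <;> linarith
    _ ≤ (2 * (‖x‖ ^ 2 + l ^ 2)) * w (projectionDepth x H) := by
        refine mul_le_mul_of_nonneg_right ?_ hw0
        nlinarith [sq_nonneg (‖x‖ - l)]
    _ ≤ 2 * C * ((2 * R) ^ 2 + l ^ 2) := by nlinarith [sq_nonneg l]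

/-- The order of quantifiers is the point: one `B` serves every law with the same `R` and `c`. -/
theorem exists_abs_pws_le (hR : 0 < R) (hc : 0 < c) (hw₁ : IsWeight w₁ 1 C₁)
    (hw₂ : IsWeight w₂ 2 C₂) : ∃ B, ∀ H : Measure (Vec d), IsProbabilityMeasure H →
      ScaleControlled H R c → ∀ i j, |pws w₁ w₂ H i j| ≤ B := by
  have hr : 0 < 1 / (1 + 2 * R / c) := by positivity
  obtain ⟨κ₁, hκ₁, h₁⟩ := exists_pos_le_weight hw₁.continuousOn hw₁.pos hr
  obtain ⟨κ₂, hκ₂, h₂⟩ := exists_pos_le_weight hw₂.continuousOn hw₂.pos hr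
  refine ⟨2 * C₂ * ((2 * R) ^ 2 + (C₁ * (2 * R) / (κ₁ / 2)) ^ 2) / (κ₂ / 2), ?_⟩
  intro H _ hH i j
  have hL := hH.norm_depthMean_le hw₁ h₁ hκ₁
  have hm := hH.half_mul_le_integral_weight hw₂ h₂ hκ₂
  have hn := norm_integral_le_of_norm_le_const (μ := H)
    (f := fun x => (x i - depthMean w₁ H i) * (x j - depthMean w₁ H j) * w₂ (projectionDepth x H))
    (.of_forall (hH.abs_integrand_le hw₂ hL i j))
  rw [probReal_univ, mul_one] at hn
  rw [pws, Matrix.of_apply, abs_div, abs_of_pos (by linarith : 0 < ∫ x, w₂ (projectionDepth x H) ∂H)]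
  have := hw₂.const_pos
  exact div_le_div₀ (by positivity) hn (half_pos hκ₂) hm

/-- A diagonal integrand is nonnegative, so it may be restricted to `S`; the normalising integral is
at most `C₂`. -/
theorem ScaleControlled.le_pws_diag (hH : ScaleControlled H R c) (hw₁ : IsWeight w₁ 1 C₁)
    (hw₂ : IsWeight w₂ 2 C₂) {S : Set (Vec d)} (hS : MeasurableSet S) {κ δ : ℝ} (hκ0 : 0 < κ)
    (hκ : ∀ x ∈ S, κ ≤ w₂ (projectionDepth x H)) (i : Fin d) (hδ0 : 0 ≤ δ)
    (hδ : ∀ x ∈ S, δ ≤ |x i - depthMean w₁ H i|) :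
    δ ^ 2 * κ * H.real S / C₂ ≤ pws w₁ w₂ H i i := by
  set L := depthMean w₁ H
  have hc := hH.continuous_weight hw₂
  have hint : Integrable (fun x : Vec d => (x i - L i) * (x i - L i) * w₂ (projectionDepth x H)) H :=
    Integrable.of_bound ((by fun_prop : Continuous fun x : Vec d =>
      (x i - L i) * (x i - L i)).mul hc).aestronglyMeasurable _ (.of_forall (hH.abs_integrand_le hw₂ le_rfl i i))
  have h1 : δ ^ 2 * κ * H.real S ≤
      ∫ x in S, (x i - L i) * (x i - L i) * w₂ (projectionDepth x H) ∂H := by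
    refine setIntegral_ge_of_const_le_real hS (measure_ne_top _ _) (fun x hx => ?_) hint.integrableOn
    have h := hδ x hx
    have : δ ^ 2 ≤ (x i - L i) * (x i - L i) := by
      rw [← abs_mul_abs_self (x i - L i)]; nlinarith
    exact mul_le_mul this (hκ x hx) hκ0.le (mul_self_nonneg _)
  have h2 := setIntegral_le_integral (s := S) hint
    (.of_forall fun x => mul_nonneg (mul_self_nonneg _) (hH.weight_pos hw₂ x).le)
  have hm : 0 < ∫ x, w₂ (projectionDepth x H) ∂H := (hH.wellDefined hw₁ hw₂).mass_pos₂
  have h3 : 0 ≤ δ ^ 2 * κ * H.real S := by positivity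
  exact div_le_div₀ (h3.trans (h1.trans h2)) (h1.trans h2) hm (hH.integral_weight_le hw₂)

end Functional

/-! ### Contaminated laws and their projections. -/

section Contamination

variable {d : ℕ} {F G : Measure (Vec d)} {ε : ℝ}

theorem isProbabilityMeasure_contaminate [IsProbabilityMeasure F] [IsProbabilityMeasure G]
    (hε : ε ∈ Icc (0 : ℝ) 1) : IsProbabilityMeasure (contaminate F G ε) := by
  constructor
  have h := ENNReal.ofReal_add (sub_nonneg.2 hε.2) hε.1
  simp only [contaminate, Measure.add_apply, Measure.smul_apply, measure_univ, smul_eq_mul, mul_one]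
  rw [← h]; simp

theorem contaminate_real_apply [IsProbabilityMeasure F] [IsProbabilityMeasure G]
    (hε : ε ∈ Icc (0 : ℝ) 1) (s : Set (Vec d)) :
    (contaminate F G ε).real s = (1 - ε) * F.real s + ε * G.real s := by
  have h1 := sub_nonneg.2 hε.2
  rw [measureReal_def, contaminate, Measure.add_apply, Measure.smul_apply, Measure.smul_apply,
    smul_eq_mul, smul_eq_mul, ENNReal.toReal_add
      (ENNReal.mul_ne_top ENNReal.ofReal_ne_top (measure_ne_top _ _))
      (ENNReal.mul_ne_top ENNReal.ofReal_ne_top (measure_ne_top _ _)), ENNReal.toReal_mul,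
    ENNReal.toReal_mul, ENNReal.toReal_ofReal h1, ENNReal.toReal_ofReal hε.1]
  rfl

theorem proj_contaminate (F G : Measure (Vec d)) (ε : ℝ) (u : Vec d) :
    proj (contaminate F G ε) u =
      ENNReal.ofReal (1 - ε) • proj F u + ENNReal.ofReal ε • proj G u := by
  simp only [proj, contaminate]
  rw [Measure.map_add _ _ (measurable_inner_left u), Measure.map_smul, Measure.map_smul]

theorem proj_contaminate_real_apply [IsProbabilityMeasure F] [IsProbabilityMeasure G]
    (hε : ε ∈ Icc (0 : ℝ) 1) (u : Vec d) {s : Set ℝ} (hs : MeasurableSet s) :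
    (proj (contaminate F G ε) u).real s = (1 - ε) * (proj F u).real s + ε * (proj G u).real s := by
  rw [proj_real_apply _ _ hs, proj_real_apply _ _ hs, proj_real_apply _ _ hs,
    contaminate_real_apply hε]

theorem exists_lt_real_closedBall (F : Measure (Vec d)) [IsProbabilityMeasure F] (y : Vec d)
    {q : ℝ} (hq : q < 1) : ∃ R, 0 < R ∧ q < F.real (Metric.closedBall y R) := by
  have h : Tendsto (fun n : ℕ => F (Metric.closedBall y n)) atTop
      (𝓝 (F (⋃ n : ℕ, Metric.closedBall y n))) :=
    tendsto_measure_iUnion_atTop fun m n hmn =>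
      Metric.closedBall_subset_closedBall (by exact_mod_cast hmn)
  rw [Metric.iUnion_closedBall_nat, measure_univ] at h
  have h' := (ENNReal.tendsto_toReal ENNReal.one_ne_top).comp h
  obtain ⟨n, hn, hn0⟩ := ((h'.eventually (lt_mem_nhds
    (show q < (1 : ℝ≥0∞).toReal by simpa using hq))).and (eventually_gt_atTop 0)).exists
  exact ⟨n, by exact_mod_cast hn0, hn⟩

end Contamination

/-! ### Symmetric laws on the line. -/

section Symmetric

variable {K : Measure ℝ} [IsProbabilityMeasure K]

theorem real_Iic_zero_eq_real_Ici_zero {K : Measure ℝ} (hK : (K.map fun t => -t) = K) :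
    K.real (Iic 0) = K.real (Ici 0) := by
  conv_lhs => rw [← hK]
  rw [map_measureReal_apply measurable_neg measurableSet_Iic]
  congr 1; ext x; simp

/-- The closed half-line from `0` pointing away from `b` has mass at least `1/2` by symmetry, and
all its points are at distance at least `|b|` from `b`. -/
theorem half_le_real_abs_sub (hK : (K.map fun t => -t) = K) (b : ℝ) :
    1 / 2 ≤ K.real {t | |b| ≤ |t - b|} := by
  have h1 := real_Iic_zero_eq_real_Ici_zero hK
  have h2 := measureReal_union_le (μ := K) (Iic 0) (Ici 0)
  rw [Iic_union_Ici, probReal_univ] at h2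
  obtain hb | hb := le_total b 0
  · refine le_trans (by linarith) (measureReal_mono (s₁ := Ici 0) fun t (ht : 0 ≤ t) => ?_)
    show |b| ≤ |t - b|
    rw [abs_of_nonpos hb, abs_of_nonneg (by linarith)]; linarith
  · refine le_trans (by linarith) (measureReal_mono (s₁ := Iic 0) fun t (ht : t ≤ 0) => ?_)
    show |b| ≤ |t - b|
    rw [abs_of_nonneg hb, abs_of_nonpos (by linarith)]; linarith

end Symmetric

/-! ### Elliptical laws and the mixture with a translate. -/

section Elliptical

variable {d : ℕ} {F : Measure (Vec d)} {θ : Vec d}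
  {A : Matrix (Fin d) (Fin d) ℝ}

theorem exists_pos_le_sqrt_quadForm (hA : A.PosDef) :
    ∃ σ, 0 < σ ∧ ∀ u : Vec d, ‖u‖ = 1 → σ ≤ Real.sqrt (u.ofLp ⬝ᵥ (A *ᵥ u.ofLp)) := by
  have hc : Continuous fun u : Vec d => Real.sqrt (u.ofLp ⬝ᵥ (A *ᵥ u.ofLp)) := by
    unfold dotProduct Matrix.mulVec dotProduct
    fun_prop
  obtain h | h := (Metric.sphere (0 : Vec d) 1).eq_empty_or_nonempty
  · refine ⟨1, one_pos, fun u hu => ?_⟩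
    have : u ∈ Metric.sphere (0 : Vec d) 1 := by simpa using hu
    simp [h] at this
  · obtain ⟨v, hv, hmin⟩ := (isCompact_sphere (0 : Vec d) 1).exists_isMinOn h hc.continuousOn
    refine ⟨_, Real.sqrt_pos.2 ?_, fun u hu => hmin (by simpa using hu)⟩
    have hv0 : v.ofLp ≠ 0 := by
      intro h0
      have : v = 0 := by ext i; simp [h0]
      simp [this] at hv
    simpa using hA.dotProduct_mulVec_pos hv0

theorem proj_eq_map_add (u : Vec d) :
    proj F u = (F.map fun x => inner ℝ u (x - θ)).map fun t => inner ℝ u θ + t := by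
  rw [proj, Measure.map_map (by fun_prop) (by fun_prop)]
  congr 1; ext x; simp [inner_sub_right]

theorem proj_translate (u v : Vec d) :
    proj (F.map fun x => x + v) u = (proj F u).map fun t => t + inner ℝ u v := by
  rw [proj, proj, Measure.map_map (by fun_prop) (by fun_prop),
    Measure.map_map (by fun_prop) (by fun_prop)]
  congr 1; ext x; simp [inner_add_right]

theorem IsElliptical.map_neg {ν : Measure ℝ} (hF : IsElliptical F θ A ν) {u : Vec d}
    (hu : ‖u‖ = 1) : ((F.map fun x => inner ℝ u (x - θ)).map fun t => -t) =
      F.map fun x => inner ℝ u (x - θ) := by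
  rw [hF.proj_eq u hu, Measure.map_map (by fun_prop) (by fun_prop)]
  conv_rhs => rw [← hF.symm, Measure.map_map (by fun_prop) (by fun_prop)]
  congr 1; ext t; simp

variable [IsProbabilityMeasure F]

/-- Absolute continuity of the integral of `p` bounds the mass of all short intervals at once,
wherever they lie. Undoing the scaling by `√(u'Au)`, bounded below on the sphere by `σ`, turns an
interval of radius `σ * τ'` into one of radius at most `τ'`. -/
theorem exists_pos_real_proj_closedBall_lt [NeZero d] {p : ℝ → ℝ}
    (hF : IsElliptical F θ A (volume.withDensity fun t => ENNReal.ofReal (p t)))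
    {η : ℝ} (hη : 0 < η) :
    ∃ δ, 0 < δ ∧ ∀ u : Vec d, ‖u‖ = 1 → ∀ m, (proj F u).real (Metric.closedBall m δ) < η := by
  obtain ⟨σ, hσ, hσu⟩ := exists_pos_le_sqrt_quadForm hF.posDef
  -- The density has total mass one because `F` does and push-forwards preserve mass.
  have hfin : ∫⁻ t, ENNReal.ofReal (p t) ≠ ⊤ := by
    obtain ⟨u, hu⟩ : ∃ u : Vec d, ‖u‖ = 1 := exists_norm_eq _ zero_le_one
    have h := congrArg (fun μ : Measure ℝ => μ univ) (hF.proj_eq u hu)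
    simp only at h
    rw [Measure.map_apply (by fun_prop) .univ, Measure.map_apply (by fun_prop) .univ,
      preimage_univ, preimage_univ, measure_univ, withDensity_apply _ .univ, setLIntegral_univ] at h
    rw [← h]; exact ENNReal.one_ne_top
  obtain ⟨τ, hτ, hsmall⟩ := exists_pos_setLIntegral_lt_of_measure_lt hfin
    (ε := ENNReal.ofReal η) (by simpa using hη)
  obtain ⟨τ', hτ'0, hτ'⟩ : ∃ τ' : ℝ, 0 < τ' ∧ ENNReal.ofReal (2 * τ') < τ := by
    obtain ⟨r, hr0, hr⟩ := ENNReal.lt_iff_exists_nnreal_btwn.1 hτ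
    refine ⟨r / 2, by have : 0 < r := by simpa using hr0
                      positivity, ?_⟩
    rw [mul_div_cancel₀ _ two_ne_zero]; simpa using hr
  refine ⟨σ * τ', by positivity, fun u hu m => ?_⟩
  have hs := hσu u hu
  set s := Real.sqrt (u.ofLp ⬝ᵥ (A *ᵥ u.ofLp))
  have hs0 : 0 < s := hσ.trans_le hs
  rw [proj_eq_map_add (θ := θ) u, hF.proj_eq u hu, Measure.map_map (by fun_prop) (by fun_prop),
    measureReal_def, Measure.map_apply (by fun_prop)
      (Metric.isClosed_closedBall (x := m)).measurableSet,
    withDensity_apply _ ((Metric.isClosed_closedBall (x := m)).measurableSet.preimage (by fun_prop))]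
  refine ENNReal.toReal_lt_of_lt_ofReal (hsmall _ (lt_of_le_of_lt ?_ hτ'))
  rw [← Real.volume_closedBall ((m - inner ℝ u θ) / s) τ']
  refine measure_mono fun t ht => ?_
  simp only [mem_preimage, Function.comp_apply, Metric.mem_closedBall, Real.dist_eq] at ht ⊢
  have h1 : inner ℝ u θ + s * t - m = s * (t - (m - inner ℝ u θ) / s) := by field_simp; ring
  rw [h1, abs_mul, abs_of_pos hs0] at ht
  have h2 : s * |t - (m - inner ℝ u θ) / s| ≤ s * τ' :=
    ht.trans (mul_le_mul_of_nonneg_right hs hτ'0.le)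
  exact le_of_mul_le_mul_left h2 hs0

/-- The balanced mixture of `F` and its translate by `v`. -/
noncomputable def translateMix (F : Measure (Vec d)) (v : Vec d) : Measure (Vec d) :=
  contaminate F (F.map fun x => x + v) (1 / 2)

instance (v : Vec d) : IsProbabilityMeasure (F.map fun x => x + v) :=
  Measure.isProbabilityMeasure_map (by fun_prop)

theorem half_mem_Icc : (1 / 2 : ℝ) ∈ Icc (0 : ℝ) 1 := by constructor <;> norm_num

instance (v : Vec d) : IsProbabilityMeasure (translateMix F v) :=
  isProbabilityMeasure_contaminate half_mem_Icc

variable {ν : Measure ℝ}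

/-- Reflection about this point swaps the projections of `F` and of its translate, and the mixture
gives them equal weights. -/
theorem median_proj_translateMix (hF : IsElliptical F θ A ν) {u : Vec d} (hu : ‖u‖ = 1)
    (v : Vec d) :
    median (proj (translateMix F v) u) = inner ℝ u θ + inner ℝ u v / 2 := by
  apply median_eq_of_map_eq
  have h1 : ((proj F u).map fun t => 2 * (inner ℝ u θ + inner ℝ u v / 2) - t) =
      proj (F.map fun x => x + v) u := by
    have hs := hF.map_neg hu
    rw [proj_translate, proj_eq_map_add (θ := θ) u]
    generalize (F.map fun x => inner ℝ u (x - θ)) = K at hs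
    rw [Measure.map_map (by fun_prop) (by fun_prop)]
    conv_rhs => rw [Measure.map_map (by fun_prop) (by fun_prop), ← hs,
      Measure.map_map (by fun_prop) (by fun_prop)]
    congr 1; ext t; simp; ring
  have h2 : ((proj (F.map fun x => x + v) u).map
      fun t => 2 * (inner ℝ u θ + inner ℝ u v / 2) - t) = proj F u := by
    rw [← h1, Measure.map_map (by fun_prop) (by fun_prop)]
    have e : ((fun t => 2 * (inner ℝ u θ + inner ℝ u v / 2) - t) ∘
        fun t => 2 * (inner ℝ u θ + inner ℝ u v / 2) - t) = id := by ext t; simp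
    rw [e, Measure.map_id]
  rw [translateMix, proj_contaminate, Measure.map_add _ _ (by fun_prop), Measure.map_smul,
    Measure.map_smul, h1, h2, add_comm]
  norm_num

/-- Seen from the common median, each component is symmetric about a point at distance `|u'v| / 2`,
so at least half of its mass is that far away. The factor `2` comes from `half_le_mad`. -/
theorem abs_inner_le_mad_translateMix (hF : IsElliptical F θ A ν) {u : Vec d} (hu : ‖u‖ = 1)
    (v : Vec d) : |inner ℝ u v / 2| ≤ 2 * mad (proj (translateMix F v) u) := by
  have : IsProbabilityMeasure (F.map fun x => inner ℝ u (x - θ)) :=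
    Measure.isProbabilityMeasure_map (by fun_prop)
  suffices h : |inner ℝ u v / 2| / 2 ≤ mad (proj (translateMix F v) u) by linarith
  apply half_le_mad
  rw [median_proj_translateMix hF hu]
  have hm : MeasurableSet {t : ℝ | |inner ℝ u v / 2| ≤ |t - (inner ℝ u θ + inner ℝ u v / 2)|} :=
    measurableSet_le measurable_const (measurable_abs_sub _)
  have h1 := half_le_real_abs_sub (hF.map_neg hu) (inner ℝ u v / 2)
  have h2 := half_le_real_abs_sub (hF.map_neg hu) (-(inner ℝ u v / 2))
  rw [translateMix, proj_contaminate_real_apply half_mem_Icc u hm, proj_translate,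
    map_measureReal_apply (by fun_prop) hm]
  have e1 : (fun t => inner ℝ u θ + t) ⁻¹'
      {t : ℝ | |inner ℝ u v / 2| ≤ |t - (inner ℝ u θ + inner ℝ u v / 2)|} =
      {t | |inner ℝ u v / 2| ≤ |t - inner ℝ u v / 2|} := by
    ext t; simp only [mem_preimage, mem_ofPred_eq]; ring_nf
  have e2 : (fun t => inner ℝ u θ + t) ⁻¹' ((fun t => t + inner ℝ u v) ⁻¹'
      {t : ℝ | |inner ℝ u v / 2| ≤ |t - (inner ℝ u θ + inner ℝ u v / 2)|}) =
      {t | |(-(inner ℝ u v / 2))| ≤ |t - -(inner ℝ u v / 2)|} := by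
    ext t; simp only [mem_preimage, mem_ofPred_eq, abs_neg]; ring_nf
  rw [← e1, ← map_measureReal_apply (by fun_prop) hm, ← proj_eq_map_add] at h1
  rw [← e2, ← map_measureReal_apply (by fun_prop) (hm.preimage (by fun_prop)),
    ← proj_eq_map_add] at h2
  linarith

theorem scaleControlled_translateMix {δ R : ℝ} (hδ0 : 0 < δ) (v : Vec d)
    (hδ : ∀ u : Vec d, ‖u‖ = 1 → ∀ m, (proj F u).real (Metric.closedBall m δ) < 1 / 2)
    (hR0 : 0 < R) (hR : 1 / 2 < (translateMix F v).real (Metric.closedBall 0 R)) :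
    ScaleControlled (translateMix F v) R δ where
  radius_pos := hR0
  scale_pos := hδ0
  half_lt := hR
  le_mad u hu := by
    refine le_mad fun m => ?_
    have hm := (Metric.isClosed_closedBall (x := m) (ε := δ)).measurableSet
    rw [translateMix, proj_contaminate_real_apply half_mem_Icc u hm, proj_translate,
      map_measureReal_apply (by fun_prop) hm]
    have h1 := hδ u hu m
    have h2 := hδ u hu (m - inner ℝ u v)
    have e : (fun t => t + inner ℝ u v) ⁻¹' Metric.closedBall m δ =
        Metric.closedBall (m - inner ℝ u v) δ := by
      ext t; simp only [mem_preimage, Metric.mem_closedBall, Real.dist_eq]; ring_nf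
    rw [e]
    linarith

end Elliptical

/-! ### Finite bias below one half, explosion at one half. -/

section Breakdown

variable {d : ℕ} [NeZero d] {F : Measure (Vec d)} [IsProbabilityMeasure F] {θ : Vec d}
  {A : Matrix (Fin d) (Fin d) ℝ} {w₁ w₂ : ℝ → ℝ} {C₁ C₂ : ℝ}

theorem exists_scaleControlled_contaminate {p : ℝ → ℝ}
    (hF : IsElliptical F θ A (volume.withDensity fun t => ENNReal.ofReal (p t)))
    {ε : ℝ} (hε : ε ∈ Ico (0 : ℝ) (1 / 2)) :
    ∃ R c, 0 < R ∧ 0 < c ∧ ∀ G : Measure (Vec d), IsProbabilityMeasure G →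
      ScaleControlled (contaminate F G ε) R c := by
  have hε' : ε ∈ Icc (0 : ℝ) 1 := ⟨hε.1, by linarith [hε.2]⟩
  have hpos : 0 < 1 - ε := by linarith [hε.2]
  -- Chosen so that `(1 - ε) * η + ε = 1/2`: even with all of `G` on it, a short interval stays
  -- below mass `1/2`.
  obtain ⟨c, hc, hsmall⟩ := exists_pos_real_proj_closedBall_lt hF
    (η := (1 / 2 - ε) / (1 - ε)) (div_pos (by linarith [hε.2]) hpos)
  -- Here `(1 - ε) * q = 1/2`, and `q < 1` precisely because `ε < 1/2`.
  obtain ⟨R, hR, hball⟩ := exists_lt_real_closedBall F 0 (q := 1 / 2 / (1 - ε))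
    (by rw [div_lt_one hpos]; linarith [hε.2])
  refine ⟨R, c, hR, hc, fun G _ => ?_⟩
  have := isProbabilityMeasure_contaminate (F := F) (G := G) hε'
  refine ⟨hR, hc, ?_, fun u hu => le_mad fun m => ?_⟩
  · rw [contaminate_real_apply hε']
    rw [div_lt_iff₀ hpos] at hball
    nlinarith [mul_nonneg hε.1 (measureReal_nonneg (μ := G) (s := Metric.closedBall 0 R))]
  · rw [proj_contaminate_real_apply hε' u Metric.isClosed_closedBall.measurableSet]
    have h1 := hsmall u hu m
    rw [lt_div_iff₀ hpos] at h1
    have h2 : (proj G u).real (Metric.closedBall m c) ≤ 1 := measureReal_le_one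
    nlinarith [mul_le_mul_of_nonneg_left h2 hε.1]

theorem outlyingness_le_of_abs_inner_sub_median_le {H : Measure (Vec d)} [IsProbabilityMeasure H]
    {R c : ℝ} (hH : ScaleControlled H R c) {y : Vec d} {k : ℝ}
    (hy : ∀ u : Vec d, ‖u‖ = 1 →
      inner ℝ u y - median (proj H u) ≤ k * mad (proj H u)) (x : Vec d) :
    outlyingness x H ≤ k + c⁻¹ * ‖x - y‖ := by
  refine (hH.outlyingness_le_add x y).trans ?_
  gcongr
  exact ScaleControlled.outlyingness_le fun u hu => (div_le_iff₀ (hH.mad_pos hu)).2 (hy u hu)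

/-- A far translate of `F`, mixed with `F` in equal parts, makes the scatter matrix explode: the
depth of the points near either centre stays bounded away from zero. -/
theorem exists_le_pws_translateMix {p : ℝ → ℝ}
    (hF : IsElliptical F θ A (volume.withDensity fun t => ENNReal.ofReal (p t)))
    (hw₁ : IsWeight w₁ 1 C₁) (hw₂ : IsWeight w₂ 2 C₂) (i : Fin d) :
    ∃ r κ : ℝ, 0 < r ∧ 0 < κ ∧ ∀ n : ℝ, 2 * r ≤ n →
      WellDefined w₁ w₂ (translateMix F (EuclideanSpace.single i n)) ∧
      (n / 2 - r) ^ 2 * κ ≤ pws w₁ w₂ (translateMix F (EuclideanSpace.single i n)) i i := by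
  obtain ⟨c, hc, hsmall⟩ := exists_pos_real_proj_closedBall_lt hF (η := 1 / 2) (by norm_num)
  obtain ⟨r, hr, hball⟩ := exists_lt_real_closedBall F θ (q := 1 / 2) (by norm_num)
  -- Outlyingness is at most `2` at a centre and gains at most `r / c` within distance `r`.
  obtain ⟨κ, hκ, hκw⟩ := exists_pos_le_weight hw₂.continuousOn hw₂.pos
    (r₀ := 1 / (1 + (2 + c⁻¹ * r))) (by positivity)
  have hC₂ := hw₂.const_pos
  -- The ball about a centre has mass above `1/2` under the matching component, hence at least `1/4`
  -- under the mixture.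
  refine ⟨r, κ * (1 / 4) / C₂, hr, by positivity, fun n hn => ?_⟩
  set v : Vec d := EuclideanSpace.single i n with hv
  -- This `R` depends on `n`, but serves only well-definedness and integrability; it does not enter
  -- the lower bound.
  obtain ⟨R, hR, hRball⟩ := exists_lt_real_closedBall (translateMix F v) 0 (q := 1 / 2) (by norm_num)
  have hH := scaleControlled_translateMix hc v hsmall hR hRball
  refine ⟨hH.wellDefined hw₁ hw₂, ?_⟩
  have key : ∀ y : Vec d, (∀ u : Vec d, ‖u‖ = 1 →
      inner ℝ u y - median (proj (translateMix F v) u) ≤ 2 * mad (proj (translateMix F v) u)) →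
      1 / 4 ≤ (translateMix F v).real (Metric.closedBall y r) →
      n / 2 ≤ |y i - depthMean w₁ (translateMix F v) i| →
      (n / 2 - r) ^ 2 * (κ * (1 / 4) / C₂) ≤ pws w₁ w₂ (translateMix F v) i i := by
    intro y hy hmass hdist
    refine le_trans ?_ (hH.le_pws_diag hw₁ hw₂ (S := Metric.closedBall y r)
      Metric.isClosed_closedBall.measurableSet hκ (fun x hx => hκw _ ⟨hH.projectionDepth_ge ?_,
        hH.projectionDepth_le_one x⟩) i (δ := n / 2 - r) (by linarith) fun x hx => ?_)
    · rw [← mul_div_assoc, ← mul_assoc]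
      gcongr
    · refine (outlyingness_le_of_abs_inner_sub_median_le hH hy x).trans ?_
      rw [Metric.mem_closedBall, dist_eq_norm] at hx
      gcongr
    · rw [Metric.mem_closedBall, dist_eq_norm] at hx
      have h1 : |x i - y i| ≤ r := by
        have := PiLp.norm_apply_le (x - y) i
        exact le_trans (by simpa using this) hx
      have h2 := abs_sub_le (y i) (x i) (depthMean w₁ (translateMix F v) i)
      rw [abs_sub_comm (y i) (x i)] at h2
      linarith
  have hmed := fun (u : Vec d) (hu : ‖u‖ = 1) => median_proj_translateMix hF hu v
  have hmad := fun (u : Vec d) (hu : ‖u‖ = 1) => abs_inner_le_mad_translateMix hF hu v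
  have hbr : ∀ y, (translateMix F v).real (Metric.closedBall y r) =
      (1 - 1 / 2) * F.real (Metric.closedBall y r) +
        1 / 2 * F.real (Metric.closedBall (y - v) r) := by
    intro y
    rw [translateMix, contaminate_real_apply half_mem_Icc,
      map_measureReal_apply (by fun_prop) Metric.isClosed_closedBall.measurableSet]
    congr 3
    ext x
    simp only [mem_preimage, Metric.mem_closedBall, dist_eq_norm]
    rw [sub_sub_eq_add_sub]
  -- The `i`-th coordinates of the centres differ by `n`, so one of them is at least `n / 2` from
  -- that of the mean.
  obtain h | h := le_total (n / 2) |θ i - depthMean w₁ (translateMix F v) i|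
  · refine key θ (fun u hu => ?_) ?_ h
    · rw [hmed u hu]
      linarith [hmad u hu, neg_abs_le (inner ℝ u v / 2)]
    · rw [hbr]
      linarith [measureReal_nonneg (μ := F) (s := Metric.closedBall (θ - v) r)]
  · refine key (θ + v) (fun u hu => ?_) ?_ ?_
    · rw [hmed u hu, inner_add_right]
      linarith [hmad u hu, le_abs_self (inner ℝ u v / 2)]
    · rw [hbr, add_sub_cancel_right]
      linarith [measureReal_nonneg (μ := F) (s := Metric.closedBall (θ + v) r)]
    · have h1 : (θ + v) i = θ i + n := by simp [hv]
      rw [h1]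
      have := neg_abs_le (θ i - depthMean w₁ (translateMix F v) i)
      exact le_trans (by linarith) (le_abs_self _)

theorem maxBias_lt_top (N : Seminorm ℝ (Matrix (Fin d) (Fin d) ℝ)) {p : ℝ → ℝ}
    (hF : IsElliptical F θ A (volume.withDensity fun t => ENNReal.ofReal (p t)))
    (hw₁ : IsWeight w₁ 1 C₁) (hw₂ : IsWeight w₂ 2 C₂) {ε : ℝ} (hε : ε ∈ Ico (0 : ℝ) (1 / 2)) :
    maxBias N w₁ w₂ F ε < ⊤ := by
  obtain ⟨R, c, hR, hc, hH⟩ := exists_scaleControlled_contaminate hF hε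
  obtain ⟨B, hB⟩ := exists_abs_pws_le (d := d) hR hc hw₁ hw₂
  obtain ⟨C, hC, hN⟩ := seminorm_matrix_le N
  refine lt_of_le_of_lt (iSup_le fun G => iSup₂_le fun hG _ => ENNReal.ofReal_le_ofReal ?_)
    (ENNReal.ofReal_lt_top (r := C * B + N (pws w₁ w₂ F)))
  have hprob : IsProbabilityMeasure (contaminate F G ε) :=
    isProbabilityMeasure_contaminate ⟨hε.1, by linarith [hε.2]⟩
  exact (map_sub_le_add N _ _).trans (add_le_add_left (hN _ _ (hB _ hprob (hH G hG))) _)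

theorem maxBias_half_eq_top (N : Seminorm ℝ (Matrix (Fin d) (Fin d) ℝ))
    (hN : ∀ M, N M = 0 → M = 0) {p : ℝ → ℝ}
    (hF : IsElliptical F θ A (volume.withDensity fun t => ENNReal.ofReal (p t)))
    (hw₁ : IsWeight w₁ 1 C₁) (hw₂ : IsWeight w₂ 2 C₂) : maxBias N w₁ w₂ F (1 / 2) = ⊤ := by
  let i : Fin d := 0
  obtain ⟨r, κ, hr, hκ, h⟩ := exists_le_pws_translateMix hF hw₁ hw₂ i
  obtain ⟨C, hC, hNC⟩ := exists_le_seminorm N hN (Matrix.entryLinearMap ℝ ℝ i i)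
  refine ENNReal.eq_top_of_forall_nnreal_le fun b => ?_
  -- With `n = 2 * (r + t)` the lower bound becomes `t² κ`, which is at least `t κ` since `t ≥ 1`,
  -- and so exceeds `C b` plus the size of the entry at `F`.
  set t : ℝ := 1 + (C * b + |pws w₁ w₂ F i i|) / κ with ht
  have ht1 : 1 ≤ t := by
    have : 0 ≤ (C * b + |pws w₁ w₂ F i i|) / κ := by positivity
    linarith
  obtain ⟨hwd, hge⟩ := h (2 * (r + t)) (by linarith)
  set v : Vec d := EuclideanSpace.single i (2 * (r + t))
  have h1 : C * b ≤ C * N (pws w₁ w₂ (translateMix F v) - pws w₁ w₂ F) := by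
    refine le_trans ?_ (hNC _)
    refine le_trans ?_ (le_abs_self _)
    rw [Matrix.entryLinearMap_apply, Matrix.sub_apply]
    have e : 2 * (r + t) / 2 - r = t := by ring
    rw [e] at hge
    have h2 : t * κ ≤ t ^ 2 * κ := by gcongr; nlinarith
    have h3 : t * κ = κ + (C * b + |pws w₁ w₂ F i i|) := by rw [ht]; field_simp
    linarith [le_abs_self (pws w₁ w₂ F i i)]
  have h2 : (b : ℝ) ≤ N (pws w₁ w₂ (translateMix F v) - pws w₁ w₂ F) := le_of_mul_le_mul_left h1 hC
  calc (b : ℝ≥0∞) = ENNReal.ofReal b := (ENNReal.ofReal_coe_nnreal).symm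
    _ ≤ ENNReal.ofReal (N (pws w₁ w₂ (translateMix F v) - pws w₁ w₂ F)) :=
      ENNReal.ofReal_le_ofReal h2
    _ ≤ maxBias N w₁ w₂ F (1 / 2) :=
      le_iSup_of_le (F.map fun x => x + v) (le_iSup₂_of_le inferInstance hwd le_rfl)

end Breakdown

end PDScatter

theorem corollary3p3 {d : ℕ} (hd : 1 ≤ d)
    (F : Measure (Vec d)) [IsProbabilityMeasure F]
    (θ : Vec d) (A : Matrix (Fin d) (Fin d) ℝ)
    (p : ℝ → ℝ) (hp_cont : Continuous p) (hp_nonneg : ∀ t, 0 ≤ p t)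
    (hF : IsElliptical F θ A (volume.withDensity fun t => ENNReal.ofReal (p t)))
    (m₀ : ℝ) (hm₀ : mad (volume.withDensity fun t => ENNReal.ofReal (p t)) = m₀)
    (hp_pos : 0 < p 0 * p m₀)
    (w₁ w₂ : ℝ → ℝ)
    (hw₁_diff : DifferentiableOn ℝ w₁ (Icc 0 1))
    (hw₂_diff : DifferentiableOn ℝ w₂ (Icc 0 1))
    (hw₁_cont : ContinuousOn (derivWithin w₁ (Icc 0 1)) (Icc 0 1))
    (hw₂_lip : ∃ K : ℝ≥0, LipschitzOnWith K (derivWithin w₂ (Icc 0 1)) (Icc 0 1))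
    (hw₁_bigO : derivWithin w₁ (Icc 0 1) =O[𝓝[≥] (0 : ℝ)] fun r : ℝ => r)
    (hw₂_bigO : derivWithin w₂ (Icc 0 1) =O[𝓝[≥] (0 : ℝ)] fun r : ℝ => r ^ 2)
    (hw₁_zero : w₁ 0 = 0) (hw₂_zero : w₂ 0 = 0)
    (hw₁_pos : ∀ r ∈ Ioc (0 : ℝ) 1, 0 < w₁ r)
    (hw₂_pos : ∀ r ∈ Ioc (0 : ℝ) 1, 0 < w₂ r)
    (N : Seminorm ℝ (Matrix (Fin d) (Fin d) ℝ)) (hN : ∀ M, N M = 0 → M = 0) :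
    (∀ ε ∈ Ico (0 : ℝ) (1 / 2), ∀ G : Measure (Vec d), IsProbabilityMeasure G →
      WellDefined w₁ w₂ (contaminate F G ε)) ∧
    IsBreakdownPoint N w₁ w₂ F (1 / 2) := by

  have : NeZero d := ⟨by omega⟩
  obtain ⟨C₁, hC₁, h₁⟩ := weight_le_mul hw₁_diff hw₁_cont hw₁_zero
  obtain ⟨C₂, hC₂, h₂⟩ := weight_le_mul_sq hw₂_diff hw₂_lip hw₂_bigO hw₂_zero
  have hW₁ : IsWeight w₁ 1 C₁ :=
    ⟨hw₁_diff.continuousOn, hw₁_pos, hC₁, fun r hr => by simpa using h₁ r hr⟩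
  have hW₂ : IsWeight w₂ 2 C₂ := ⟨hw₂_diff.continuousOn, hw₂_pos, hC₂, h₂⟩
  refine ⟨fun ε hε G hG => ?_, ⟨half_mem_Icc, maxBias_half_eq_top N hN hF hW₁ hW₂⟩, ?_⟩
  · obtain ⟨R, c, -, -, hH⟩ := exists_scaleControlled_contaminate hF hε
    have := isProbabilityMeasure_contaminate (F := F) (G := G) (ε := ε)
      ⟨hε.1, by linarith [hε.2]⟩
    exact (hH G hG).wellDefined hW₁ hW₂
  · rintro ε ⟨hε, htop⟩
    by_contra! hlt
    exact (maxBias_lt_top N hF hW₁ hW₂ ⟨hε.1, hlt⟩).ne htop
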